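/- Let $-\infty<a<b<\infty$ and let $s\in\mathbb C$ with $\operatorname{Re}(s)\in(-1,0)$. For locally absolutely continuous $f:(a,b)\to\mathbb C$ put $$(\alpha_s f)(x)=f'(x)-\frac{s+\frac12}{x-a}\,f(x)\quad\text{for a.e. } x\in(a,b).$$ Let $\dot A_{s,\min}$ be the operator in $L^2((a,b);dx)$ (complex-valued functions) given by $\dot A_{s,\min}f=\alpha_s f$ on $$\operatorname{dom}(\dot A_{s,\min})=\big\{f\in L^2((a,b);dx)\ \big|\ f\in AC_{loc}((a,b)),\ \operatorname{supp}(f)\subset(a,b)\text{ compact},\ \alpha_s f\in L^2((a,b);dx)\big\}.$$ Then $\dot A_{s,\min}$ is closable, and its closure $A_{s,\min}=\overline{\dot A_{s,\min}}$ satisfies $$\operatorname{dom}(A_{s,\min})=H_0^1((a,b)),$$ where $H_0^1((a,b))\subset L^2((a,b);dx)$ is the completion of $C_0^\infty((a,b))$ in the norm of $H^1((a,b))$, i.e. the set of all $u\in L^2((a,b);dx)$ for which there are $\varphi_n\in C_0^\infty((a,b))$ with $\varphi_n\to u$ in $L^2$ and $(\varphi_n')$ convergent in $L^2$. -/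

import Mathlib

open MeasureTheory Set

noncomputable section

namespace BesselFirstOrder

/-- Lebesgue measure on the open interval `(a,b)`. -/
abbrev lebIoo (a b : ℝ) : Measure ℝ := volume.restrict (Ioo a b)

/-- The complex Hilbert space `L²((a,b); dx)`. -/
abbrev L2 (a b : ℝ) : Type := Lp ℂ 2 (lebIoo a b)

/-- `f ∈ AC_loc((a,b))`: `f` is absolutely continuous on every compact interval
`[c,d] ⊂ (a,b)`. -/
def ACloc (a b : ℝ) (f : ℝ → ℂ) : Prop :=
  ∀ c d : ℝ, a < c → c ≤ d → d < b → AbsolutelyContinuousOnInterval f c d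

/-- The function `f` on `(a,b)` vanishes outside of a compact subset of `(a,b)`. -/
def CompactSuppIn (a b : ℝ) (f : ℝ → ℂ) : Prop :=
  ∃ K : Set ℝ, IsCompact K ∧ K ⊆ Ioo a b ∧ ∀ x ∈ Ioo a b, x ∉ K → f x = 0

/-- The differential expression `α_s f = f' - (s + 1/2) (x - a)⁻¹ f`. -/
def alpha (a : ℝ) (s : ℂ) (f : ℝ → ℂ) (x : ℝ) : ℂ :=
  deriv f x - (s + 1 / 2) / ((x - a : ℝ) : ℂ) * f x

/-- A complex function in `AC_loc((a,b))` is differentiable almost everywhere on `(a,b)`. -/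
theorem ACloc.ae_differentiableAt {a b : ℝ} {f : ℝ → ℂ} (hf : ACloc a b f) :
    ∀ᵐ x ∂(lebIoo a b), DifferentiableAt ℝ f x := by
  have h : ∀ p : ℚ × ℚ, ∀ᵐ x : ℝ, a < p.1 → (p.1 : ℝ) ≤ p.2 → (p.2 : ℝ) < b →
      x ∈ uIcc (p.1 : ℝ) p.2 → DifferentiableAt ℝ f x := by
    intro p
    by_cases hp : a < p.1 ∧ (p.1 : ℝ) ≤ p.2 ∧ (p.2 : ℝ) < b
    · filter_upwards [(hf _ _ hp.1 hp.2.1 hp.2.2).boundedVariationOn.ae_differentiableAt_of_mem_uIcc]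
        with x hx _ _ _ using hx
    · exact Filter.Eventually.of_forall fun x h1 h2 h3 => absurd ⟨h1, h2, h3⟩ hp
  rw [← ae_all_iff] at h
  rw [ae_restrict_iff' measurableSet_Ioo]
  filter_upwards [h] with x hx hxab
  obtain ⟨p, hp1, hp2⟩ := exists_rat_btwn hxab.1
  obtain ⟨q, hq1, hq2⟩ := exists_rat_btwn hxab.2
  exact hx (p, q) hp1 (hp2.trans hq1).le hq2 (by
    rw [uIcc_of_le (hp2.trans hq1).le]; exact ⟨hp2.le, hq1.le⟩)

theorem ACloc.continuousOn {a b : ℝ} {f : ℝ → ℂ} (hf : ACloc a b f) :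
    ContinuousOn f (Ioo a b) := by
  intro x hx
  obtain ⟨p, hp1, hp2⟩ := exists_between hx.1
  obtain ⟨q, hq1, hq2⟩ := exists_between hx.2
  have hc := (hf p q hp1 (hp2.trans hq1).le hq2).continuousOn
  rw [uIcc_of_le (hp2.trans hq1).le] at hc
  exact (hc.continuousAt (Icc_mem_nhds hp2 hq1)).continuousWithinAt

/-- Graph of the preminimal operator: all pairs `(f, α_s f) ∈ L² × L²` such that
`f ∈ AC_loc((a,b))` has compact support in `(a,b)`. Classes are handled through
representatives. -/
def preminGraph (a b : ℝ) (s : ℂ) : Submodule ℂ (L2 a b × L2 a b) where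
  carrier := {p | ∃ f : ℝ → ℂ, ACloc a b f ∧ CompactSuppIn a b f ∧
    (p.1 : ℝ → ℂ) =ᵐ[lebIoo a b] f ∧ (p.2 : ℝ → ℂ) =ᵐ[lebIoo a b] alpha a s f}
  zero_mem' := by
    refine ⟨fun _ => 0, fun c d _ _ _ => ?_, ⟨∅, isCompact_empty, empty_subset _, by simp⟩, ?_, ?_⟩
    · simpa [AbsolutelyContinuousOnInterval] using tendsto_const_nhds
    · exact Lp.coeFn_zero ℂ 2 (lebIoo a b)
    · filter_upwards [Lp.coeFn_zero ℂ 2 (lebIoo a b)] with x hx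
      simpa [alpha] using hx
  add_mem' := by
    rintro p q ⟨f, hf, ⟨K, hK, hKs, hK0⟩, hpf, hpf'⟩ ⟨g, hg, ⟨L, hL, hLs, hL0⟩, hqg, hqg'⟩
    refine ⟨f + g, fun c d h1 h2 h3 => (hf c d h1 h2 h3).add (hg c d h1 h2 h3),
      ⟨K ∪ L, hK.union hL, union_subset hKs hLs, fun x hx hxKL => ?_⟩, ?_, ?_⟩
    · rw [mem_union, not_or] at hxKL
      simp [hK0 x hx hxKL.1, hL0 x hx hxKL.2]
    · exact (Lp.coeFn_add p.1 q.1).trans (hpf.add hqg)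
    · filter_upwards [Lp.coeFn_add p.2 q.2, hpf', hqg', hf.ae_differentiableAt,
        hg.ae_differentiableAt] with x h1 h2 h3 h4 h5
      change (↑↑(p.2 + q.2) : ℝ → ℂ) x = _
      rw [h1, Pi.add_apply, h2, h3]
      simp only [alpha, deriv_add h4 h5, Pi.add_apply]
      ring
  smul_mem' := by
    rintro c p ⟨f, hf, ⟨K, hK, hKs, hK0⟩, hpf, hpf'⟩
    refine ⟨c • f, fun x y h1 h2 h3 => (hf x y h1 h2 h3).const_smul c,
      ⟨K, hK, hKs, fun x hx hxK => by simp [hK0 x hx hxK]⟩, ?_, ?_⟩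
    · exact (Lp.coeFn_smul c p.1).trans (hpf.const_smul c)
    · filter_upwards [Lp.coeFn_smul c p.2, hpf', hf.ae_differentiableAt] with x h1 h2 h3
      change (↑↑(c • p.2) : ℝ → ℂ) x = _
      rw [h1, Pi.smul_apply, h2]
      simp only [alpha, deriv_const_smul c h3, Pi.smul_apply, smul_eq_mul]
      ring

/-- `preminGraph` is single-valued, hence the graph of an operator. -/
theorem preminGraph_single_valued (a b : ℝ) (s : ℂ) :
    ∀ p ∈ preminGraph a b s, p.1 = 0 → p.2 = 0 := by
  rintro p ⟨f, hf, -, hpf, hpf'⟩ h0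
  have hf0 : f =ᵐ[lebIoo a b] fun _ => 0 := by
    rw [h0] at hpf
    exact hpf.symm.trans (Lp.coeFn_zero ℂ 2 (lebIoo a b))
  have hfz : EqOn f (fun _ => 0) (Ioo a b) :=
    Measure.eqOn_open_of_ae_eq hf0 isOpen_Ioo hf.continuousOn continuousOn_const
  rw [Lp.eq_zero_iff_ae_eq_zero]
  filter_upwards [hpf', ae_restrict_mem measurableSet_Ioo] with x hx hxab
  rw [hx, alpha, hfz hxab,
    (Filter.eventuallyEq_of_mem (isOpen_Ioo.mem_nhds hxab) hfz).deriv_eq]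
  simp

/-- The preminimal operator in `L²((a,b); dx)`: `f ↦ α_s f` on the compactly supported
`f ∈ L² ∩ AC_loc((a,b))` with `α_s f ∈ L²`. -/
def Apremin (a b : ℝ) (s : ℂ) : L2 a b →ₗ.[ℂ] L2 a b :=
  (preminGraph a b s).toLinearPMap

theorem Apremin_graph (a b : ℝ) (s : ℂ) : (Apremin a b s).graph = preminGraph a b s :=
  Submodule.toLinearPMap_graph_eq _ (preminGraph_single_valued a b s)

/-- The minimal operator: the operator closure of the preminimal operator. -/
def Amin (a b : ℝ) (s : ℂ) : L2 a b →ₗ.[ℂ] L2 a b :=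
  (Apremin a b s).closure

/-- The pairs `(φ, φ') ∈ L² × L²` with `φ ∈ C₀^∞((a,b))`; with the graph norm this is
`C₀^∞((a,b))` in the norm of `H¹((a,b))`. -/
def testGraph (a b : ℝ) : Submodule ℂ (L2 a b × L2 a b) where
  carrier := {p | ∃ φ : ℝ → ℂ, ContDiff ℝ (⊤ : ℕ∞) φ ∧ HasCompactSupport φ ∧
    tsupport φ ⊆ Ioo a b ∧
    (p.1 : ℝ → ℂ) =ᵐ[lebIoo a b] φ ∧ (p.2 : ℝ → ℂ) =ᵐ[lebIoo a b] deriv φ}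
  zero_mem' := by
    refine ⟨fun _ => 0, contDiff_const, HasCompactSupport.zero, ?_, ?_, ?_⟩
    · have : tsupport (fun _ : ℝ => (0 : ℂ)) = ∅ := tsupport_eq_empty_iff.2 rfl
      simp [this]
    · exact Lp.coeFn_zero ℂ 2 (lebIoo a b)
    · filter_upwards [Lp.coeFn_zero ℂ 2 (lebIoo a b)] with x hx
      simpa using hx
  add_mem' := by
    rintro p q ⟨f, hf, hfc, hfs, hpf, hpf'⟩ ⟨g, hg, hgc, hgs, hqg, hqg'⟩
    refine ⟨f + g, hf.add hg, hfc.add hgc, (tsupport_add f g).trans (union_subset hfs hgs), ?_, ?_⟩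
    · exact (Lp.coeFn_add p.1 q.1).trans (hpf.add hqg)
    · filter_upwards [Lp.coeFn_add p.2 q.2, hpf', hqg'] with x h1 h2 h3
      change (↑↑(p.2 + q.2) : ℝ → ℂ) x = _
      rw [h1, Pi.add_apply, h2, h3, deriv_add (hf.differentiable (by simp) x)
        (hg.differentiable (by simp) x)]
  smul_mem' := by
    rintro c p ⟨f, hf, hfc, hfs, hpf, hpf'⟩
    refine ⟨c • f, contDiff_const.smul hf, hfc.smul_left (f := fun _ => c),
      (tsupport_smul_subset_right (fun _ => c) f).trans hfs, ?_, ?_⟩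
    · exact (Lp.coeFn_smul c p.1).trans (hpf.const_smul c)
    · filter_upwards [Lp.coeFn_smul c p.2, hpf'] with x h1 h2
      change (↑↑(c • p.2) : ℝ → ℂ) x = _
      rw [h1, Pi.smul_apply, h2, deriv_const_smul c (hf.differentiable (by simp) x)]

/-- The Sobolev space `H₀¹((a,b))` as a subspace of `L²((a,b); dx)`: the completion of
`C₀^∞((a,b))` in the norm of `H¹((a,b))`. Thus `u` belongs to it iff there are test functions
`φₙ` with `φₙ → u` and `φₙ'` convergent, both in `L²`. -/
def H10 (a b : ℝ) : Submodule ℂ (L2 a b) :=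
  (testGraph a b).topologicalClosure.map (LinearMap.fst ℂ (L2 a b) (L2 a b))

end BesselFirstOrder

end

namespace BesselFirstOrder

/-! The heart is a Hardy inequality, `exists_mul_inv_sub`: integrating the derivative of |f|²/(x-a)
gives ‖f/(x-a)‖ ≤ ‖α_s f‖/(-Re s) for compactly supported f. Since α_t f = α_s f + (s-t) f/(x-a),
the expressions for any two parameters with negative real part bound each other, so their closures
have the same domain (`map_fst_topologicalClosure_le`). For t = -1/2 the singular term disappears
and α_t is d/dx. It remains to see that test functions are H¹-dense among the compactly supported AC
functions with L² derivative. No mollifier is used: f' is approximated by mean-zero test functions,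
whose primitives are again test functions, and the Hardy bound yields convergence of the primitives.
Closability is integration by parts against test functions. -/

/-! ### Calculus of locally absolutely continuous functions -/

theorem exists_Ioo_of_isCompact {a b : ℝ} (hab : a < b) {K : Set ℝ} (hK : IsCompact K)
    (hKs : K ⊆ Ioo a b) : ∃ c d : ℝ, a < c ∧ c < d ∧ d < b ∧ K ⊆ Ioo c d := by
  rcases K.eq_empty_or_nonempty with rfl | hne
  · obtain ⟨c, hac, hcb⟩ := exists_between hab
    obtain ⟨d, hcd, hdb⟩ := exists_between hcb
    exact ⟨c, d, hac, hcd, hdb, empty_subset _⟩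
  · obtain ⟨m, hm, hm'⟩ := hK.exists_isLeast hne
    obtain ⟨M, hM, hM'⟩ := hK.exists_isGreatest hne
    obtain ⟨c, hac, hcm⟩ := exists_between (hKs hm).1
    obtain ⟨d, hMd, hdb⟩ := exists_between (hKs hM).2
    exact ⟨c, d, hac, (hcm.trans_le (hM' hm)).trans hMd, hdb, fun x hx =>
      ⟨hcm.trans_le (hm' hx), (hM' hx).trans_lt hMd⟩⟩

/-- Post-composition with a contraction preserves absolute continuity. -/
theorem absolutelyContinuousOnInterval_comp_of_dist_le {X Y : Type*} [PseudoMetricSpace X]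
    [PseudoMetricSpace Y] {g : X → Y} (hg : ∀ x y, dist (g x) (g y) ≤ dist x y)
    {f : ℝ → X} {c d : ℝ} (hf : AbsolutelyContinuousOnInterval f c d) :
    AbsolutelyContinuousOnInterval (fun x => g (f x)) c d := by
  refine squeeze_zero (fun t => ?_) (fun t => ?_) hf
  · exact Finset.sum_nonneg fun i _ => dist_nonneg
  · exact Finset.sum_le_sum fun i _ => hg _ _

theorem ACloc.mul {a b : ℝ} {f g : ℝ → ℂ} (hf : ACloc a b f) (hg : ACloc a b g) :
    ACloc a b (fun x => f x * g x) :=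
  fun c d h1 h2 h3 => (hf c d h1 h2 h3).smul (hg c d h1 h2 h3)

theorem ACloc.conj {a b : ℝ} {f : ℝ → ℂ} (hf : ACloc a b f) :
    ACloc a b (fun x => (starRingEnd ℂ) (f x)) :=
  fun c d h1 h2 h3 => absolutelyContinuousOnInterval_comp_of_dist_le
    (fun x y => (Complex.dist_conj_conj x y).le) (hf c d h1 h2 h3)

theorem ACloc_of_contDiffOn {a b : ℝ} {f : ℝ → ℂ} (hf : ContDiffOn ℝ 1 f (Ioo a b)) :
    ACloc a b f := fun c d h1 h2 h3 =>
  (hf.mono (by rw [uIcc_of_le h2]; exact Icc_subset_Ioo h1 h3)).absolutelyContinuousOnInterval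

theorem ACloc_inv_sub (a b : ℝ) : ACloc a b (fun x => (((x - a : ℝ) : ℂ))⁻¹) := by
  refine ACloc_of_contDiffOn (ContDiffOn.inv ?_ fun x hx => ?_)
  · exact (Complex.ofRealCLM.contDiff.comp (contDiff_id.sub contDiff_const)).contDiffOn
  · exact_mod_cast (sub_pos.2 hx.1).ne'

theorem hasDerivAt_inv_sub {a x : ℝ} (hx : a < x) :
    HasDerivAt (fun x : ℝ => (((x - a : ℝ) : ℂ))⁻¹) (-(((x - a : ℝ) : ℂ))⁻¹ ^ 2) x := by
  have h : HasDerivAt (fun x : ℝ => ((x - a : ℝ) : ℂ)) 1 x := by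
    simpa using ((hasDerivAt_id x).sub_const a).ofReal_comp
  have h0 : ((x - a : ℝ) : ℂ) ≠ 0 := by exact_mod_cast (sub_pos.2 hx).ne'
  refine (h.inv h0).congr_deriv ?_
  field_simp

/-- A complex absolutely continuous function satisfies the fundamental theorem of calculus. -/
theorem intervalIntegral_deriv_eq_sub {f : ℝ → ℂ} {c d : ℝ}
    (hf : AbsolutelyContinuousOnInterval f c d) (hi : IntervalIntegrable (deriv f) volume c d) :
    ∫ x in c..d, deriv f x = f d - f c := by
  -- Reduction to the real-valued theorem through Re and Im, which are contractions and so preserve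
  -- absolute continuity.
  have key : ∀ T : ℂ →L[ℝ] ℝ, (∀ z w, dist (T z) (T w) ≤ dist z w) →
      T (∫ x in c..d, deriv f x) = T (f d - f c) := by
    intro T hT
    rw [← T.intervalIntegral_comp_comm hi, map_sub,
      ← (absolutelyContinuousOnInterval_comp_of_dist_le hT hf).integral_deriv_eq_sub]
    refine intervalIntegral.integral_congr_ae ?_
    filter_upwards [hf.boundedVariationOn.ae_differentiableAt_of_mem_uIcc] with x hx hx'
    exact (T.hasFDerivAt.comp_hasDerivAt x (hx (uIoc_subset_uIcc hx')).hasDerivAt).deriv.symm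
  apply Complex.ext
  · refine key Complex.reCLM fun z w => ?_
    rw [Complex.dist_eq, Real.dist_eq]
    exact Complex.abs_re_le_norm (z - w)
  · refine key Complex.imCLM fun z w => ?_
    rw [Complex.dist_eq, Real.dist_eq]
    exact Complex.abs_im_le_norm (z - w)

theorem CompactSuppIn.mono {a b : ℝ} {f g : ℝ → ℂ} (hf : CompactSuppIn a b f)
    (h : ∀ x, f x = 0 → g x = 0) : CompactSuppIn a b g := by
  obtain ⟨K, hK, hKs, hK0⟩ := hf
  exact ⟨K, hK, hKs, fun x hx hxK => h x (hK0 x hx hxK)⟩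

/-- Absolute continuity is only local, so the fundamental theorem is applied on some [c,d] inside
(a,b) with the support in (c,d); both boundary values vanish. -/
theorem integral_deriv_eq_zero {a b : ℝ} (hab : a < b) {f : ℝ → ℂ} (hf : ACloc a b f)
    (hs : CompactSuppIn a b f) (hi : Integrable (deriv f) (lebIoo a b)) :
    ∫ x, deriv f x ∂(lebIoo a b) = 0 := by
  obtain ⟨K, hK, hKs, hK0⟩ := hs
  obtain ⟨c, d, hac, hcd, hdb, hKcd⟩ := exists_Ioo_of_isCompact hab hK hKs
  have hsub : Ioc c d ⊆ Ioo a b := fun x hx => ⟨hac.trans hx.1, hx.2.trans_lt hdb⟩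
  have h0 : ∀ x ∈ Ioo a b \ Ioc c d, deriv f x = 0 := by
    rintro x ⟨hx, hx'⟩
    have hxK : x ∉ K := fun h => hx' ⟨(hKcd h).1, (hKcd h).2.le⟩
    have : f =ᶠ[nhds x] fun _ => 0 := by
      filter_upwards [isOpen_Ioo.mem_nhds hx, hK.isClosed.isOpen_compl.mem_nhds hxK] with y h1 h2
      exact hK0 y h1 h2
    rw [this.deriv_eq]
    simp
  have hI : IntervalIntegrable (deriv f) volume c d := by
    rw [intervalIntegrable_iff_integrableOn_Ioc_of_le hcd.le]
    exact IntegrableOn.mono_set hi hsub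
  rw [setIntegral_eq_of_subset_of_forall_sdiff_eq_zero measurableSet_Ioo hsub h0,
    ← intervalIntegral.integral_of_le hcd.le,
    intervalIntegral_deriv_eq_sub (hf c d hac hcd.le hdb) hI,
    hK0 c ⟨hac, hcd.trans hdb⟩ fun h => (hKcd h).1.false,
    hK0 d ⟨hac.trans hcd, hdb⟩ fun h => (hKcd h).2.false, sub_zero]

/-! ### The weighted Hardy inequality and its consequences -/

theorem norm_sq_eq_integral {α : Type*} {m : MeasurableSpace α} {μ : Measure α} (g : Lp ℂ 2 μ)
    {f : α → ℂ} (h : (g : α → ℂ) =ᵐ[μ] f) : ‖g‖ ^ 2 = ∫ x, ‖f x‖ ^ 2 ∂μ := by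
  have h1 : ((‖g‖ ^ 2 : ℝ) : ℂ) = ∫ x, inner ℂ (g x) (g x) ∂μ := by
    rw [← L2.inner_def, inner_self_eq_norm_sq_to_K]
    simp
  have h2 : ∫ x, inner ℂ (g x) (g x) ∂μ = ((∫ x, ‖f x‖ ^ 2 ∂μ : ℝ) : ℂ) := by
    rw [← integral_complex_ofReal]
    refine integral_congr_ae ?_
    filter_upwards [h] with x hx
    rw [hx, inner_self_eq_norm_sq_to_K]
    simp
  exact_mod_cast h1.trans h2

theorem CompactSuppIn.memLp_mul_inv_sub {a b : ℝ} {f : ℝ → ℂ} (hf : ContinuousOn f (Ioo a b))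
    (hs : CompactSuppIn a b f) : MemLp (fun x => f x * ((x - a : ℝ) : ℂ)⁻¹) 2 (lebIoo a b) := by
  obtain ⟨K, hK, hKs, hK0⟩ := hs
  have hc : ContinuousOn (fun x => f x * ((x - a : ℝ) : ℂ)⁻¹) (Ioo a b) :=
    hf.mul (ACloc_inv_sub a b).continuousOn
  obtain ⟨C, hC⟩ := hK.exists_bound_of_continuousOn (hc.mono hKs)
  refine MemLp.of_bound (hc.aestronglyMeasurable measurableSet_Ioo) (max C 0) ?_
  filter_upwards [ae_restrict_mem measurableSet_Ioo] with x hx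
  by_cases hxK : x ∈ K
  · exact (hC x hxK).trans (le_max_left _ _)
  · rw [hK0 x hx hxK]
    simp

/-- Pointwise form of the weighted Hardy inequality. -/
theorem hardy_pointwise {δ : ℝ} (hδ : 0 < δ) {s : ℂ} (hs : s.re = -δ) (α z r : ℂ)
    (hr : (starRingEnd ℂ) r = r) :
    (((α + (s + 1 / 2) * (z * r)) * (starRingEnd ℂ) z +
      z * (starRingEnd ℂ) (α + (s + 1 / 2) * (z * r))) * r +
      z * (starRingEnd ℂ) z * (-r ^ 2)).re ≤ δ⁻¹ * ‖α‖ ^ 2 - δ * ‖z * r‖ ^ 2 := by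
  have hi : r.im = 0 := by
    have := congrArg Complex.im hr
    simp at this
    linarith
  rw [← Complex.normSq_eq_norm_sq, ← Complex.normSq_eq_norm_sq]
  -- Right side minus left side equals δ⁻¹|α - δzr|²: the +1 in 2 Re(s + 1/2) cancels the -r² from
  -- differentiating the weight.
  have h : 0 ≤ δ⁻¹ * ((α.re - δ * (z.re * r.re)) ^ 2 + (α.im - δ * (z.im * r.re)) ^ 2) := by
    positivity
  simp only [Complex.normSq_apply, Complex.add_re, Complex.mul_re, Complex.mul_im, Complex.add_im,
    Complex.conj_re, Complex.conj_im, Complex.neg_re, Complex.neg_im, pow_two, hi, hs,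
    map_add, map_mul]
  norm_num
  rw [← sub_nonneg]
  convert h using 1
  field_simp
  ring

theorem deriv_eq_alpha_add (a : ℝ) (s : ℂ) (f : ℝ → ℂ) (x : ℝ) :
    deriv f x = alpha a s f x + (s + 1 / 2) * (f x * ((x - a : ℝ) : ℂ)⁻¹) := by
  rw [alpha]
  ring

/-- Weighted Hardy inequality: for `Re s < 0`, division by `x - a` is bounded relative to
`α_s` on compactly supported functions. -/
theorem exists_mul_inv_sub {a b : ℝ} (hab : a < b) {s : ℂ} (hs : s.re < 0)
    {p : L2 a b × L2 a b} {f : ℝ → ℂ} (hf : ACloc a b f) (hc : CompactSuppIn a b f)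
    (hp : (p.2 : ℝ → ℂ) =ᵐ[lebIoo a b] alpha a s f) :
    ∃ w : L2 a b, (w : ℝ → ℂ) =ᵐ[lebIoo a b] (fun x => f x * ((x - a : ℝ) : ℂ)⁻¹) ∧
      ‖w‖ ≤ (-s.re)⁻¹ * ‖p.2‖ := by
  have hδ : 0 < -s.re := neg_pos.2 hs
  set δ := -s.re with hδ'
  have hq := hc.memLp_mul_inv_sub hf.continuousOn
  have hα : MemLp (alpha a s f) 2 (lebIoo a b) := (memLp_congr_ae hp).1 (Lp.memLp p.2)
  refine ⟨hq.toLp, hq.coeFn_toLp, ?_⟩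
  set z : ℝ → ℂ := fun x => f x * ((x - a : ℝ) : ℂ)⁻¹ with hz
  -- G = |f|²/(x-a); the pointwise bound on Re G' is integrated against ∫ G' = 0.
  let G : ℝ → ℂ := fun x => f x * (starRingEnd ℂ) (f x) * ((x - a : ℝ) : ℂ)⁻¹
  have hG : ACloc a b G := (hf.mul hf.conj).mul (ACloc_inv_sub a b)
  have hGc : CompactSuppIn a b G := hc.mono fun x hx => by simp [G, hx]
  have hconj : ∀ x : ℝ, (starRingEnd ℂ) (((x - a : ℝ) : ℂ)⁻¹) = ((x - a : ℝ) : ℂ)⁻¹ := by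
    intro x
    rw [map_inv₀, Complex.conj_ofReal]
  have hder : ∀ᵐ x ∂(lebIoo a b), deriv G x =
      (deriv f x * (starRingEnd ℂ) (f x) + f x * (starRingEnd ℂ) (deriv f x)) *
        ((x - a : ℝ) : ℂ)⁻¹ + f x * (starRingEnd ℂ) (f x) * (-((x - a : ℝ) : ℂ)⁻¹ ^ 2) := by
    filter_upwards [hf.ae_differentiableAt, ae_restrict_mem measurableSet_Ioo] with x hx hx'
    have hconj : HasDerivAt (fun x => (starRingEnd ℂ) (f x)) ((starRingEnd ℂ) (deriv f x)) x :=
      Complex.conjCLE.hasFDerivAt.comp_hasDerivAt x hx.hasDerivAt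
    exact ((hx.hasDerivAt.mul hconj).mul (hasDerivAt_inv_sub hx'.1)).deriv
  have hGi : Integrable (deriv G) (lebIoo a b) := by
    have hd : MemLp (deriv f) 2 (lebIoo a b) := by
      refine (memLp_congr_ae (Filter.Eventually.of_forall fun x => ?_)).2
        (hα.add (hq.const_mul (s + 1 / 2)))
      exact deriv_eq_alpha_add a s f x
    have hq' : MemLp (fun x => (starRingEnd ℂ) (z x)) 2 (lebIoo a b) := hq.star
    have hd' : MemLp (fun x => (starRingEnd ℂ) (deriv f x)) 2 (lebIoo a b) := hd.star
    refine (((hd.integrable_mul hq').add (hq.integrable_mul hd')).sub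
      (hq.integrable_mul hq')).congr ?_
    filter_upwards [hder] with x hx
    rw [hx]
    simp only [Pi.add_apply, Pi.sub_apply, Pi.mul_apply, hz, map_mul, hconj]
    ring
  have hzero : ∫ x, (deriv G x).re ∂(lebIoo a b) = 0 := by
    have := congrArg Complex.re (integral_deriv_eq_zero hab hG hGc hGi)
    rw [← Complex.reCLM_apply, ← Complex.reCLM.integral_comp_comm hGi] at this
    exact this
  have hi1 : Integrable (fun x => ‖alpha a s f x‖ ^ 2) (lebIoo a b) :=
    hα.integrable_norm_pow (by norm_num)
  have hi2 : Integrable (fun x => ‖z x‖ ^ 2) (lebIoo a b) := hq.integrable_norm_pow (by norm_num)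
  have hle : 0 ≤ δ⁻¹ * ‖p.2‖ ^ 2 - δ * ‖hq.toLp‖ ^ 2 := by
    rw [norm_sq_eq_integral p.2 hp, norm_sq_eq_integral _ hq.coeFn_toLp,
      ← integral_const_mul, ← integral_const_mul, ← integral_sub (hi1.const_mul _)
      (hi2.const_mul _), ← hzero]
    refine integral_mono_ae hGi.re ((hi1.const_mul _).sub (hi2.const_mul _)) ?_
    filter_upwards [hder] with x hx
    rw [hx, deriv_eq_alpha_add a s f x]
    exact hardy_pointwise hδ (by simp [hδ']) (alpha a s f x) (f x) _ (hconj x)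
  refine abs_le_of_sq_le_sq' ?_ (by positivity) |>.2
  rw [mul_pow]
  have : δ * ‖hq.toLp‖ ^ 2 ≤ δ⁻¹ * ‖p.2‖ ^ 2 := by linarith
  calc ‖hq.toLp‖ ^ 2 = δ⁻¹ * (δ * ‖hq.toLp‖ ^ 2) := by field_simp
    _ ≤ δ⁻¹ * (δ⁻¹ * ‖p.2‖ ^ 2) := by gcongr
    _ = δ⁻¹ ^ 2 * ‖p.2‖ ^ 2 := by ring

/-- Since 0 < x - a < b - a, the Hardy bound implies a Poincaré inequality. -/
theorem norm_fst_le {a b : ℝ} (hab : a < b) {s : ℂ} (hs : s.re < 0) {p : L2 a b × L2 a b}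
    (hp : p ∈ preminGraph a b s) : ‖p.1‖ ≤ (b - a) * ((-s.re)⁻¹ * ‖p.2‖) := by
  obtain ⟨f, hf, hc, hp1, hp2⟩ := hp
  obtain ⟨w, hw, hle⟩ := exists_mul_inv_sub hab hs hf hc hp2
  refine (Lp.norm_le_mul_norm_of_ae_le_mul (c := b - a) (g := w) ?_).trans
    (mul_le_mul_of_nonneg_left hle (sub_pos.2 hab).le)
  filter_upwards [hp1, hw, ae_restrict_mem measurableSet_Ioo] with x h1 h2 h3
  have hx : 0 < x - a := sub_pos.2 h3.1
  rw [h1, h2, norm_mul, norm_inv, Complex.norm_real, Real.norm_of_nonneg hx.le]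
  calc ‖f x‖ = (x - a) * (‖f x‖ * (x - a)⁻¹) := by field_simp
    _ ≤ (b - a) * (‖f x‖ * (x - a)⁻¹) := by gcongr; exact h3.2.le

/-- Changing the parameter adds (s-t) f/(x-a), which Hardy controls by α_s f. -/
theorem exists_mem_preminGraph {a b : ℝ} (hab : a < b) {s : ℂ} (hs : s.re < 0) (t : ℂ)
    {p : L2 a b × L2 a b} (hp : p ∈ preminGraph a b s) :
    ∃ q ∈ preminGraph a b t, q.1 = p.1 ∧ ‖q.2‖ ≤ (1 + ‖s - t‖ * (-s.re)⁻¹) * ‖p.2‖ := by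
  obtain ⟨f, hf, hc, hp1, hp2⟩ := hp
  obtain ⟨w, hw, hle⟩ := exists_mul_inv_sub hab hs hf hc hp2
  refine ⟨(p.1, p.2 + (s - t) • w), ⟨f, hf, hc, hp1, ?_⟩, rfl, ?_⟩
  · filter_upwards [Lp.coeFn_add p.2 ((s - t) • w), Lp.coeFn_smul (s - t) w, hp2, hw]
      with x h1 h2 h3 h4
    rw [h1, Pi.add_apply, h2, Pi.smul_apply, h3, h4, alpha, alpha, smul_eq_mul]
    ring
  · calc ‖p.2 + (s - t) • w‖ ≤ ‖p.2‖ + ‖s - t‖ * ‖w‖ := by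
          simpa only [norm_smul] using norm_add_le p.2 ((s - t) • w)
      _ ≤ ‖p.2‖ + ‖s - t‖ * ((-s.re)⁻¹ * ‖p.2‖) := by gcongr
      _ = _ := by ring

/-! ### Comparison of closures -/

/-- If `A ⊆ X × Y` is dominated by the graph `B` of an operator, then every first component
of an element of the closure of `A` is a first component of the closure of `B`. -/
theorem map_fst_topologicalClosure_le {𝕜 X Y : Type*} [NormedField 𝕜] [NormedAddCommGroup X]
    [NormedSpace 𝕜 X] [NormedAddCommGroup Y] [NormedSpace 𝕜 Y] [CompleteSpace Y]
    {A B : Submodule 𝕜 (X × Y)} (hB : ∀ p ∈ B, p.1 = 0 → p.2 = 0) (C : ℝ)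
    (h : ∀ p ∈ A, ∃ q ∈ B, q.1 = p.1 ∧ ‖q.2‖ ≤ C * ‖p.2‖) :
    A.topologicalClosure.map (LinearMap.fst 𝕜 X Y) ≤
      B.topologicalClosure.map (LinearMap.fst 𝕜 X Y) := by
  rintro _ ⟨p, hp, rfl⟩
  obtain ⟨u, hu, hlim⟩ := mem_closure_iff_seq_limit.1 hp
  choose q hqB hq1 hq2 using h
  let v : ℕ → X × Y := fun n => q (u n) (hu n)
  have hv : ∀ m n, ‖(v m).2 - (v n).2‖ ≤ C * ‖(u m).2 - (u n).2‖ := by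
    intro m n
    have hsub : u m - u n ∈ A := A.sub_mem (hu m) (hu n)
    -- The partners are chosen independently; single-valuedness of `B` forces the partner of a
    -- difference to be the difference of the partners.
    have h0 := hB (v m - v n - q _ hsub)
      (B.sub_mem (B.sub_mem (hqB _ (hu m)) (hqB _ (hu n))) (hqB _ hsub))
      (by simp only [v, Prod.fst_sub, hq1, sub_self])
    have h1 : (v m).2 - (v n).2 = (q _ hsub).2 := sub_eq_zero.1 h0
    rw [h1]
    exact hq2 _ hsub
  have hcau : CauchySeq fun n => (v n).2 := by
    have hu2 : CauchySeq fun n => (u n).2 := ((continuous_snd.tendsto p).comp hlim).cauchySeq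
    rw [Metric.cauchySeq_iff'] at hu2 ⊢
    intro ε hε
    obtain ⟨N, hN⟩ := hu2 (ε / (|C| + 1)) (by positivity)
    refine ⟨N, fun n hn => ?_⟩
    have h1 := hN n hn
    rw [dist_eq_norm] at h1 ⊢
    calc ‖(v n).2 - (v N).2‖ ≤ C * ‖(u n).2 - (u N).2‖ := hv n N
      _ ≤ (|C| + 1) * ‖(u n).2 - (u N).2‖ := by
        gcongr
        linarith [le_abs_self C]
      _ < (|C| + 1) * (ε / (|C| + 1)) := by gcongr
      _ = ε := by field_simp
  obtain ⟨y, hy⟩ := cauchySeq_tendsto_of_complete hcau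
  refine ⟨(p.1, y), mem_closure_iff_seq_limit.2 ⟨v, fun n => hqB _ _, ?_⟩, rfl⟩
  have h1 : Filter.Tendsto (fun n => (v n).1) Filter.atTop (nhds p.1) := by
    simp only [v, hq1]
    exact (continuous_fst.tendsto p).comp hlim
  exact h1.prodMk_nhds hy

/-! ### Duality with test functions and closability -/

/-- Pairing with an `L²` function is a continuous linear functional on `L²`. -/
theorem exists_clm_integral_mul {α : Type*} {m : MeasurableSpace α} {μ : Measure α} {k : α → ℂ}
    (hk : MemLp k 2 μ) : ∃ T : Lp ℂ 2 μ →L[ℂ] ℂ, ∀ g : Lp ℂ 2 μ, T g = ∫ x, k x * g x ∂μ := by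
  have hk' : MemLp (fun x => (starRingEnd ℂ) (k x)) 2 μ := hk.star
  refine ⟨innerSL ℂ hk'.toLp, fun g => ?_⟩
  rw [innerSL_apply_apply, L2.inner_def]
  refine integral_congr_ae ?_
  filter_upwards [hk'.coeFn_toLp] with x hx
  rw [hx, RCLike.inner_apply, Complex.conj_conj, mul_comm]

theorem memLp_of_continuous {a b : ℝ} {k : ℝ → ℂ} (hk : Continuous k) :
    MemLp k 2 (lebIoo a b) := by
  obtain ⟨C, hC⟩ := (isCompact_Icc (a := a) (b := b)).exists_bound_of_continuousOn hk.continuousOn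
  refine MemLp.of_bound hk.aestronglyMeasurable C ?_
  filter_upwards [ae_restrict_mem measurableSet_Ioo] with x hx
  exact hC x (Ioo_subset_Icc_self hx)

/-- Fundamental lemma of the calculus of variations. Testing only real-valued φ lets it serve both
bilinear pairings and inner products. -/
theorem eq_zero_of_forall_integral_mul_eq_zero {a b : ℝ} (g : L2 a b)
    (h : ∀ φ : ℝ → ℂ, ContDiff ℝ (⊤ : ℕ∞) φ → HasCompactSupport φ → tsupport φ ⊆ Ioo a b →
      (∀ x, (starRingEnd ℂ) (φ x) = φ x) → ∫ x, φ x * g x ∂(lebIoo a b) = 0) : g = 0 := by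
  rw [Lp.eq_zero_iff_ae_eq_zero]
  have hloc : LocallyIntegrableOn (g : ℝ → ℂ) (Ioo a b) volume :=
    IntegrableOn.locallyIntegrableOn ((Lp.memLp g).integrable (by norm_num))
  have := isOpen_Ioo.ae_eq_zero_of_integral_contDiff_smul_eq_zero (U := Ioo a b) hloc
    fun φ hφ hφc hφs => ?_
  · exact (ae_restrict_iff' measurableSet_Ioo).2 this
  · have hsupp : Function.support (fun x => (φ x : ℂ)) ⊆ Function.support φ := fun x hx h0 =>
      hx (by simp [Function.notMem_support.1 (not_not.2 h0)])
    have h1 := h (fun x => (φ x : ℂ)) (Complex.ofRealCLM.contDiff.comp hφ)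
      (hφc.mono hsupp) ((closure_mono hsupp).trans hφs) fun x => Complex.conj_ofReal _
    rw [← h1, ← setIntegral_eq_integral_of_forall_compl_eq_zero (s := Ioo a b)]
    · simp only [Complex.real_smul]
    · intro x hx
      rw [image_eq_zero_of_notMem_tsupport fun h => hx (hφs h), zero_smul]

theorem compactSuppIn_of_tsupport_subset {a b : ℝ} {φ : ℝ → ℂ} (hc : HasCompactSupport φ)
    (hs : tsupport φ ⊆ Ioo a b) : CompactSuppIn a b φ :=
  ⟨tsupport φ, hc, hs, fun _ _ hx => image_eq_zero_of_notMem_tsupport hx⟩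

theorem continuous_deriv_of_smooth {φ : ℝ → ℂ} (hφ : ContDiff ℝ (⊤ : ℕ∞) φ) :
    Continuous (deriv φ) :=
  hφ.continuous_deriv (by exact_mod_cast le_top)

/-- Integration by parts against test functions characterizes limits of the graph. -/
theorem snd_eq_zero_of_mem_topologicalClosure {a b : ℝ} (hab : a < b) (s : ℂ)
    {p : L2 a b × L2 a b} (hp : p ∈ (preminGraph a b s).topologicalClosure) (h0 : p.1 = 0) :
    p.2 = 0 := by
  refine eq_zero_of_forall_integral_mul_eq_zero _ fun φ hφ hφc hφs _ => ?_
  have hφK := compactSuppIn_of_tsupport_subset hφc hφs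
  have hφ2 : MemLp φ 2 (lebIoo a b) := memLp_of_continuous hφ.continuous
  have hψ2 : MemLp (fun x => deriv φ x + (s + 1 / 2) * (φ x * ((x - a : ℝ) : ℂ)⁻¹)) 2
      (lebIoo a b) :=
    (memLp_of_continuous (continuous_deriv_of_smooth hφ)).add
      ((hφK.memLp_mul_inv_sub hφ.continuous.continuousOn).const_mul _)
  obtain ⟨T, hT⟩ := exists_clm_integral_mul hφ2
  obtain ⟨S, hS⟩ := exists_clm_integral_mul hψ2
  -- The relation is ∫ (fφ)' = 0, with the singular coefficient moved onto φ, where compact support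
  -- keeps it in L². Being closed, it passes to limits.
  have hclosed : IsClosed {q : L2 a b × L2 a b | T q.2 + S q.1 = 0} :=
    isClosed_eq (by fun_prop) continuous_const
  have hmem : p ∈ {q : L2 a b × L2 a b | T q.2 + S q.1 = 0} := by
    refine closure_minimal ?_ hclosed hp
    rintro q ⟨f, hf, hfc, hq1, hq2⟩
    have hder : ∀ᵐ x ∂(lebIoo a b), deriv (fun x => f x * φ x) x = φ x * q.2 x +
        (deriv φ x + (s + 1 / 2) * (φ x * ((x - a : ℝ) : ℂ)⁻¹)) * q.1 x := by
      filter_upwards [hf.ae_differentiableAt, hq1, hq2] with x hx h1 h2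
      rw [deriv_fun_mul hx (hφ.differentiable (by simp) x), h1, h2, alpha]
      ring
    have hI1 := hφ2.integrable_mul (Lp.memLp q.2)
    have hI2 := hψ2.integrable_mul (Lp.memLp q.1)
    have hACφ : ACloc a b φ := ACloc_of_contDiffOn (hφ.of_le (by exact_mod_cast le_top)).contDiffOn
    have := integral_deriv_eq_zero hab (hf.mul hACφ) (hfc.mono fun x hx => by simp [hx])
      ((hI1.add hI2).congr (hder.mono fun x hx => hx.symm))
    rw [integral_congr_ae hder] at this
    change T q.2 + S q.1 = 0
    rw [hT, hS, ← this]
    exact (integral_add hI1 hI2).symm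
  have hval : T p.2 + S p.1 = 0 := hmem
  rwa [h0, map_zero, add_zero, hT] at hval

/-! ### Density of test functions in the H¹ norm -/

theorem testGraph_le_preminGraph (a b : ℝ) : testGraph a b ≤ preminGraph a b (-1 / 2) := by
  rintro p ⟨φ, hφ, hφc, hφs, h1, h2⟩
  refine ⟨φ, ACloc_of_contDiffOn (hφ.of_le (by exact_mod_cast le_top)).contDiffOn,
    compactSuppIn_of_tsupport_subset hφc hφs, h1, h2.trans (Filter.Eventually.of_forall fun x => ?_)⟩
  rw [alpha]
  norm_num

theorem dense_testFunctions (a b : ℝ) :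
    ((testGraph a b).map (LinearMap.fst ℂ (L2 a b) (L2 a b))).topologicalClosure = ⊤ := by
  rw [Submodule.topologicalClosure_eq_top_iff, Submodule.eq_bot_iff]
  intro g hg
  refine eq_zero_of_forall_integral_mul_eq_zero g fun φ hφ hφc hφs hreal => ?_
  have hφ2 : MemLp φ 2 (lebIoo a b) := memLp_of_continuous hφ.continuous
  have hdφ2 : MemLp (deriv φ) 2 (lebIoo a b) :=
    memLp_of_continuous (continuous_deriv_of_smooth hφ)
  have := (Submodule.mem_orthogonal _ g).1 hg hφ2.toLp
    ⟨(hφ2.toLp, hdφ2.toLp), ⟨φ, hφ, hφc, hφs, hφ2.coeFn_toLp, hdφ2.coeFn_toLp⟩, rfl⟩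
  rw [← this, L2.inner_def]
  refine integral_congr_ae ?_
  filter_upwards [hφ2.coeFn_toLp] with x hx
  rw [hx, RCLike.inner_apply, hreal, mul_comm]

/-- A test function of mean zero is the derivative of a test function. -/
theorem exists_deriv_eq_of_integral_eq_zero {a b : ℝ} (hab : a < b) {h : ℝ → ℂ}
    (hh : ContDiff ℝ (⊤ : ℕ∞) h) (hc : HasCompactSupport h) (hs : tsupport h ⊆ Ioo a b)
    (hI : ∫ x, h x ∂(lebIoo a b) = 0) :
    ∃ φ : ℝ → ℂ, ContDiff ℝ (⊤ : ℕ∞) φ ∧ HasCompactSupport φ ∧ tsupport φ ⊆ Ioo a b ∧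
      deriv φ = h := by
  obtain ⟨c, d, hac, hcd, hdb, hK⟩ := exists_Ioo_of_isCompact hab hc hs
  have hd : deriv (fun u => ∫ x in a..u, h x) = h := funext (hh.continuous.deriv_integral h a)
  have hzero : ∀ x, x ∉ Ioo c d → h x = 0 := fun x hx =>
    image_eq_zero_of_notMem_tsupport fun h => hx (hK h)
  -- Left of c the integrand vanishes; right of d the primitive equals the total integral, which is
  -- zero.
  have hsupp : ∀ x, x ∉ Icc c d → ∫ x in a..x, h x = 0 := by
    intro x hx
    rw [mem_Icc, not_and_or, not_le, not_le] at hx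
    rcases hx with hx | hx
    · refine intervalIntegral.integral_zero_ae (Filter.Eventually.of_forall fun y hy => hzero y ?_)
      rintro ⟨h1, -⟩
      rcases mem_uIoc.1 hy with h2 | h2 <;> linarith [h2.2]
    · have h1 : ∫ y in a..b, h y = 0 := by
        rw [intervalIntegral.integral_of_le hab.le, integral_Ioc_eq_integral_Ioo, hI]
      have h2 : ∫ y in b..x, h y = 0 := by
        refine intervalIntegral.integral_zero_ae
          (Filter.Eventually.of_forall fun y hy => hzero y ?_)
        rintro ⟨-, h1⟩
        rcases mem_uIoc.1 hy with h2 | h2 <;> linarith [h2.1]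
      rw [← intervalIntegral.integral_add_adjacent_intervals
        (hh.continuous.intervalIntegrable a b) (hh.continuous.intervalIntegrable b x), h1, h2,
        add_zero]
  refine ⟨fun u => ∫ x in a..u, h x, contDiff_infty_iff_deriv.2 ⟨?_, by rwa [hd]⟩,
    HasCompactSupport.intro isCompact_Icc hsupp, ?_, hd⟩
  · exact fun x => (hh.continuous.integral_hasStrictDerivAt a x).hasDerivAt.differentiableAt
  · refine (closure_minimal (fun x hx => ?_) isClosed_Icc).trans (Icc_subset_Ioo hac hdb)
    by_contra hx'
    exact hx (hsupp x hx')

/-- Otherwise, by rescaling, every test function has mean zero, and the constant 1 would vanish in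
L². -/
theorem exists_test_integral_eq_one {a b : ℝ} (hab : a < b) :
    ∃ ψ : ℝ → ℂ, ContDiff ℝ (⊤ : ℕ∞) ψ ∧ HasCompactSupport ψ ∧ tsupport ψ ⊆ Ioo a b ∧
      ∫ x, ψ x ∂(lebIoo a b) = 1 := by
  by_contra! hcon
  have hg : MemLp (fun _ : ℝ => (1 : ℂ)) 2 (lebIoo a b) := memLp_const 1
  obtain ⟨e, he⟩ : ∃ e : L2 a b, (e : ℝ → ℂ) =ᵐ[lebIoo a b] fun _ => 1 :=
    ⟨hg.toLp, hg.coeFn_toLp⟩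
  have h0 : e = 0 := by
    refine eq_zero_of_forall_integral_mul_eq_zero _ fun φ hφ hφc hφs _ => ?_
    have hint : ∫ x, φ x * e x ∂(lebIoo a b) = ∫ x, φ x ∂(lebIoo a b) := by
      refine integral_congr_ae ?_
      filter_upwards [he] with x hx
      rw [hx, mul_one]
    rw [hint]
    by_contra hne
    refine hcon (fun x => (∫ x, φ x ∂(lebIoo a b))⁻¹ * φ x) (contDiff_const.mul hφ)
      hφc.mul_left ((tsupport_mul_subset_right).trans hφs) ?_
    rw [integral_const_mul, inv_mul_cancel₀ hne]
  have h1 := norm_sq_eq_integral e he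
  rw [h0] at h1
  simp [hab.le] at h1
  linarith

theorem snd_mem_closure_testGraph {a b : ℝ} (hab : a < b) {p : L2 a b × L2 a b}
    (hp : p ∈ preminGraph a b (-1 / 2)) :
    p.2 ∈ ((testGraph a b).map (LinearMap.snd ℂ (L2 a b) (L2 a b))).topologicalClosure := by
  obtain ⟨T, hT⟩ := exists_clm_integral_mul (memLp_const (μ := lebIoo a b) (p := 2) (1 : ℂ))
  obtain ⟨ψ, hψ, hψc, hψs, hψ1⟩ := exists_test_integral_eq_one hab
  have hψ2 : MemLp ψ 2 (lebIoo a b) := memLp_of_continuous hψ.continuous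
  have hT0 : T p.2 = 0 := by
    obtain ⟨f, hf, hfc, -, hp2⟩ := hp
    have hder : (p.2 : ℝ → ℂ) =ᵐ[lebIoo a b] deriv f := by
      filter_upwards [hp2] with x hx
      rw [hx, alpha]
      norm_num
    have hi : Integrable (p.2 : ℝ → ℂ) (lebIoo a b) := (Lp.memLp p.2).integrable (by norm_num)
    rw [hT]
    simp only [one_mul]
    rw [integral_congr_ae hder, integral_deriv_eq_zero hab hf hfc (hi.congr hder)]
  -- The continuous projection g ↦ g - (∫g)ψ removes the mean: it sends test functions to
  -- derivatives of test functions and fixes `p.2`, whose mean is zero.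
  have hmaps : MapsTo (fun g : L2 a b => g - T g • hψ2.toLp)
      ((testGraph a b).map (LinearMap.fst ℂ (L2 a b) (L2 a b)))
      ((testGraph a b).map (LinearMap.snd ℂ (L2 a b) (L2 a b))) := by
    rintro _ ⟨q, ⟨h, hh, hhc, hhs, hq, -⟩, rfl⟩
    change q.1 - T q.1 • hψ2.toLp ∈ _
    have hTq : T q.1 = ∫ x, h x ∂(lebIoo a b) := by
      rw [hT]
      simp only [one_mul]
      exact integral_congr_ae hq
    have hih : Integrable h (lebIoo a b) :=
      (memLp_of_continuous hh.continuous).integrable (q := 2) (by norm_num)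
    have hiψ : Integrable ψ (lebIoo a b) := hψ2.integrable (by norm_num)
    have hsub : tsupport (h - fun x => T q.1 * ψ x) ⊆ Ioo a b :=
      (tsupport_sub h _).trans (union_subset hhs (tsupport_mul_subset_right.trans hψs))
    obtain ⟨φ, hφ, hφc, hφs, hφd⟩ := exists_deriv_eq_of_integral_eq_zero hab
      (hh.sub (contDiff_const.mul hψ)) (hhc.sub hψc.mul_left) hsub (by
        rw [integral_sub hih (hiψ.const_mul _), integral_const_mul, hψ1, mul_one, hTq, sub_self])
    have hφ2 : MemLp φ 2 (lebIoo a b) := memLp_of_continuous hφ.continuous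
    refine ⟨(hφ2.toLp, q.1 - T q.1 • hψ2.toLp), ⟨φ, hφ, hφc, hφs, hφ2.coeFn_toLp, ?_⟩, rfl⟩
    rw [hφd]
    filter_upwards [Lp.coeFn_sub q.1 (T q.1 • hψ2.toLp), Lp.coeFn_smul (T q.1) hψ2.toLp, hq,
      hψ2.coeFn_toLp] with x h1 h2 h3 h4
    rw [h1, Pi.sub_apply, h2, Pi.smul_apply, h3, h4]
    rfl
  have hcont : Continuous fun g : L2 a b => g - T g • hψ2.toLp := by fun_prop
  have hmem : p.2 ∈ closure
      (((testGraph a b).map (LinearMap.fst ℂ (L2 a b) (L2 a b)) : Submodule ℂ (L2 a b)) :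
        Set (L2 a b)) := by
    rw [← Submodule.topologicalClosure_coe, dense_testFunctions]
    trivial
  have := map_mem_closure hcont hmem hmaps
  simp only [hT0, zero_smul, sub_zero] at this
  exact this

/-- Test functions are dense in the compactly supported absolutely continuous functions with
square integrable derivative, with respect to the `H¹` norm. -/
theorem preminGraph_le_closure_testGraph {a b : ℝ} (hab : a < b) :
    preminGraph a b (-1 / 2) ≤ (testGraph a b).topologicalClosure := by
  intro p hp
  have hs : ((-1 / 2 : ℂ)).re < 0 := by norm_num
  have h2 := snd_mem_closure_testGraph hab hp
  rw [← SetLike.mem_coe, Submodule.topologicalClosure_coe, mem_closure_iff_seq_limit] at h2 ⊢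
  obtain ⟨u, hu, hlim⟩ := h2
  choose q hq hqu using hu
  refine ⟨q, hq, ?_⟩
  have hsnd : Filter.Tendsto (fun n => (q n).2) Filter.atTop (nhds p.2) := by
    refine hlim.congr fun n => (hqu n).symm
  have hfst : Filter.Tendsto (fun n => (q n).1) Filter.atTop (nhds p.1) := by
    rw [tendsto_iff_norm_sub_tendsto_zero] at hsnd ⊢
    -- Poincaré for the differences turns convergence of derivatives into convergence of functions.
    have hle : ∀ n, ‖(q n).1 - p.1‖ ≤
        (b - a) * ((-(-1 / 2 : ℂ).re)⁻¹ * ‖(q n).2 - p.2‖) := fun n =>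
      norm_fst_le (p := q n - p) hab hs
        ((preminGraph a b (-1 / 2)).sub_mem (testGraph_le_preminGraph a b (hq n)) hp)
    refine squeeze_zero (fun _ => norm_nonneg _) hle ?_
    have hlim' := (hsnd.const_mul (-(-1 / 2 : ℂ).re)⁻¹).const_mul (b - a)
    rwa [mul_zero, mul_zero] at hlim'
  exact hfst.prodMk_nhds hsnd

end BesselFirstOrder

/-- For `Re s ∈ (-1,0)` the preminimal operator is closable, and the domain of its closure,
the minimal operator, equals `H₀¹((a,b))`. -/
theorem lemma3p5 (a b : ℝ) (hab : a < b) (s : ℂ) (hs₁ : -1 < s.re) (hs₂ : s.re < 0) :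
    (BesselFirstOrder.Apremin a b s).IsClosable ∧
      (BesselFirstOrder.Amin a b s).domain = BesselFirstOrder.H10 a b := by
  have hclos : (BesselFirstOrder.Apremin a b s).IsClosable := by
    refine ⟨(BesselFirstOrder.preminGraph a b s).topologicalClosure.toLinearPMap, ?_⟩
    rw [BesselFirstOrder.Apremin_graph, Submodule.toLinearPMap_graph_eq]
    exact fun p hp => BesselFirstOrder.snd_eq_zero_of_mem_topologicalClosure hab s hp
  refine ⟨hclos, ?_⟩
  have hhalf : ((-1 / 2 : ℂ)).re < 0 := by norm_num
  have htest : (BesselFirstOrder.testGraph a b).topologicalClosure =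
      (BesselFirstOrder.preminGraph a b (-1 / 2)).topologicalClosure :=
    le_antisymm (Submodule.topologicalClosure_mono (BesselFirstOrder.testGraph_le_preminGraph a b))
      (Submodule.topologicalClosure_minimal _
        (BesselFirstOrder.preminGraph_le_closure_testGraph hab)
        (Submodule.isClosed_topologicalClosure _))
  rw [BesselFirstOrder.Amin, ← LinearPMap.graph_map_fst_eq_domain,
    ← hclos.graph_closure_eq_closure_graph, BesselFirstOrder.Apremin_graph,
    BesselFirstOrder.H10, htest]
  -- Domination in both directions, between the parameters s and -1/2.
  exact le_antisymm
    (BesselFirstOrder.map_fst_topologicalClosure_le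
      (BesselFirstOrder.preminGraph_single_valued a b _) _
      fun p hp => BesselFirstOrder.exists_mem_preminGraph hab hs₂ _ hp)
    (BesselFirstOrder.map_fst_topologicalClosure_le
      (BesselFirstOrder.preminGraph_single_valued a b _) _
      fun p hp => BesselFirstOrder.exists_mem_preminGraph hab hhalf _ hp)
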